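/- Let $F:\mathbb R^n\rightrightarrows\mathbb R^n$ be a multifunction and $K\subset\mathbb R^n$ a closed set (the target). A trajectory of $F$ on $[0,T]$ from $x$ is an absolutely continuous $y:[0,T]\to\mathbb R^n$ with $y(0)=x$ and $\dot y(t)\in F(y(t))$ for a.e. $t\in[0,T]$. Put $\mathcal T(x)=0$ for $x\in K$ and, for $x\notin K$, $$\mathcal T(x)=\inf\{T>0:\ \text{there is a trajectory } y \text{ of } F \text{ on } [0,T] \text{ from } x \text{ with } y(T)\in K\}\in[0,+\infty]$$ ($\inf\emptyset=+\infty$). Let $\mathcal R=\{x:\mathcal T(x)<+\infty\}$ and $\mathcal R(t)=\{x:\mathcal T(x)\le t\}$. An optimal trajectory for $x_0\in\mathcal R$ is a trajectory $\bar x$ on $[0,\mathcal T(x_0)]$ from $x_0$ with $\bar x(\mathcal T(x_0))\in K$. For $S\subset\mathbb R^n$ and $x\in S$, the proximal normal cone $N^P_S(x)$ is the set of $v$ for which there is $\sigma\ge 0$ with $\langle v,y-x\rangle\le\sigma|y-x|^2$ for all $y\in S$. Let $H(x,p)=\max_{v\in F(x)}\langle v,p\rangle$. Assume: (F) $F(x)$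 is nonempty, convex and compact for every $x$; for each compact $C\subset\mathbb R^n$ there is $L>0$ with $F(x)\subset F(y)+L|y-x|\bar{\mathbb B}$ for all $x,y\in C$, where $\bar{\mathbb B}$ is the closed unit ball; there is $\gamma>0$ with $|v|\le\gamma(1+|x|)$ for all $x$ and all $v\in F(x)$. (H) For every $r>0$: (H1) there is $c\ge0$ such that for every $p$ with $|p|=1$ the function $g=H(\cdot,p)$ is semiconvex on $B(0,r)$ with constant $c$, i.e. it is continuous there and $g(x+h)+g(x-h)-2g(x)\ge -c|h|^2$ whenever $[x-h,x+h]\subset B(0,r)$; (H2) there is $L\ge 0$ such that for every $p\ne0$ the gradient $\nabla_pH(x,p)$ exists for all $x\in B(0,r)$ and $x\mapsto\nabla_pH(x,p)$ is $L$-Lipschitz on $B(0,r)$. Let $x_0\in\mathcal R\setminus K$, put $T=\mathcal T(x_0)$, let $\bar x:[0,T]\to\mathbb R^n$ be an optimal trajectory for $x_0$ and let $\bar p:[0,T]\to\mathbb R^n$ be absolutely continuous such that for a.e. $s\in[0,T]$ $$\dot{\bar x}(s)=\nabla_pH(\bar x(s),\bar p(s)),\qquad -\dot{\bar p}(s)\in\partial_xH(\bar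 x(s),\bar p(s)),$$ where $\partial_xH$ is Clarke's generalized gradient of $H(\cdot,\bar p(s))$ (the convex hull of the limits of gradients along sequences of differentiability points), and where the first equation is required only at times $s$ with $\bar p(s)\neq0$. Suppose that $-\bar p(0)\in N^P_{\mathcal R(T)}(x_0)$. Then $$-\bar p(t)\in N^P_{\mathcal R(\mathcal T(\bar x(t)))}(\bar x(t))\qquad\text{for all } t\in[0,T].$$ Moreover, at the terminal time, $-\bar p(T)\in N^P_K(\bar x(T))$. -/

import Mathlib

open Set Filter Topology MeasureTheory
open scoped ENNReal Pointwise

namespace MinimumTime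

noncomputable section

/-- Assumption (F) on a multifunction `F`: nonempty convex compact values, local Lipschitz
continuity (on compact sets, in the Hausdorff sense), and linear growth. -/
structure AssumptionF {n : ℕ}
    (F : EuclideanSpace ℝ (Fin n) → Set (EuclideanSpace ℝ (Fin n))) : Prop where
  nonempty : ∀ x, (F x).Nonempty
  convex : ∀ x, Convex ℝ (F x)
  isCompact : ∀ x, IsCompact (F x)
  locallyLipschitz : ∀ C : Set (EuclideanSpace ℝ (Fin n)), IsCompact C →
    ∃ L : ℝ, 0 < L ∧ ∀ x ∈ C, ∀ y ∈ C,
      F x ⊆ F y + (L * ‖y - x‖) • Metric.closedBall (0 : EuclideanSpace ℝ (Fin n)) 1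
  linearGrowth : ∃ γ : ℝ, 0 < γ ∧ ∀ x, ∀ v ∈ F x, ‖v‖ ≤ γ * (1 + ‖x‖)

/-- The maximized Hamiltonian `H(x, p) = max_{v ∈ F(x)} ⟨v, p⟩`. -/
def maxHamiltonian {n : ℕ} (F : EuclideanSpace ℝ (Fin n) → Set (EuclideanSpace ℝ (Fin n)))
    (x p : EuclideanSpace ℝ (Fin n)) : ℝ :=
  sSup ((fun v => inner ℝ v p) '' F x)

/-- `f` is semiconcave on `Ω` with constant `c`: it is continuous on `Ω` and
`f(x+h) + f(x-h) - 2 f(x) ≤ c |h|²` whenever `[x-h, x+h] ⊆ Ω`. -/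
def SemiconcaveOnWith {n : ℕ} (Ω : Set (EuclideanSpace ℝ (Fin n))) (c : ℝ)
    (f : EuclideanSpace ℝ (Fin n) → ℝ) : Prop :=
  ContinuousOn f Ω ∧ ∀ x h, segment ℝ (x - h) (x + h) ⊆ Ω →
    f (x + h) + f (x - h) - 2 * f x ≤ c * ‖h‖ ^ 2

/-- `f` is semiconvex with constant `c` if `-f` is semiconcave with constant `c`. -/
def SemiconvexOnWith {n : ℕ} (Ω : Set (EuclideanSpace ℝ (Fin n))) (c : ℝ)
    (f : EuclideanSpace ℝ (Fin n) → ℝ) : Prop :=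
  SemiconcaveOnWith Ω c (fun x => -f x)

/-- Assumption (H) on the maximized Hamiltonian of `F`. -/
structure AssumptionH {n : ℕ}
    (F : EuclideanSpace ℝ (Fin n) → Set (EuclideanSpace ℝ (Fin n))) : Prop where
  semiconvex : ∀ r : ℝ, 0 < r → ∃ c : ℝ, 0 ≤ c ∧
    ∀ p : EuclideanSpace ℝ (Fin n), ‖p‖ = 1 →
      SemiconvexOnWith (Metric.ball 0 r) c (fun x => maxHamiltonian F x p)
  gradient_lipschitz : ∀ r : ℝ, 0 < r → ∃ L : ℝ, 0 ≤ L ∧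
    ∀ p : EuclideanSpace ℝ (Fin n), p ≠ 0 →
      (∀ x ∈ Metric.ball (0 : EuclideanSpace ℝ (Fin n)) r,
        DifferentiableAt ℝ (maxHamiltonian F x) p) ∧
      ∀ x ∈ Metric.ball (0 : EuclideanSpace ℝ (Fin n)) r,
        ∀ y ∈ Metric.ball (0 : EuclideanSpace ℝ (Fin n)) r,
          ‖gradient (maxHamiltonian F x) p - gradient (maxHamiltonian F y) p‖ ≤ L * ‖x - y‖

/-- Clarke's generalized gradient of a (locally Lipschitz) function `f` at `x`: the convex hull of
all limits of gradients of `f` along sequences of differentiability points converging to `x`. -/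
def clarkeGradient {n : ℕ} (f : EuclideanSpace ℝ (Fin n) → ℝ) (x : EuclideanSpace ℝ (Fin n)) :
    Set (EuclideanSpace ℝ (Fin n)) :=
  convexHull ℝ {v | ∃ y : ℕ → EuclideanSpace ℝ (Fin n),
    (∀ i, DifferentiableAt ℝ f (y i)) ∧ Tendsto y atTop (𝓝 x) ∧
      Tendsto (fun i => gradient f (y i)) atTop (𝓝 v)}

/-- `x` (restricted to `[0, T]`) is a trajectory of `F` on `[0, T]` starting at `x₀`. -/
def IsTrajectory {n : ℕ} (F : EuclideanSpace ℝ (Fin n) → Set (EuclideanSpace ℝ (Fin n)))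
    (T : ℝ) (x₀ : EuclideanSpace ℝ (Fin n)) (x : ℝ → EuclideanSpace ℝ (Fin n)) : Prop :=
  AbsolutelyContinuousOnInterval x 0 T ∧ x 0 = x₀ ∧
    ∀ᵐ t ∂(volume.restrict (Icc 0 T)), ∃ v ∈ F (x t), HasDerivAt x v t

open Classical in
/-- The minimum time function: `0` on the target `K`, and outside `K` the infimum of all times
`T > 0` for which a trajectory from `x₀` is in `K` at time `T` (with `inf ∅ = ∞`). -/
def minTime {n : ℕ} (F : EuclideanSpace ℝ (Fin n) → Set (EuclideanSpace ℝ (Fin n)))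
    (K : Set (EuclideanSpace ℝ (Fin n))) (x₀ : EuclideanSpace ℝ (Fin n)) : ℝ≥0∞ :=
  if x₀ ∈ K then 0
  else sInf {τ : ℝ≥0∞ | ∃ T : ℝ, 0 < T ∧ τ = ENNReal.ofReal T ∧
    ∃ x : ℝ → EuclideanSpace ℝ (Fin n), IsTrajectory F T x₀ x ∧ x T ∈ K}

/-- The sublevel set `R(t) = {x | minTime x ≤ t}`. -/
def reachableAt {n : ℕ} (F : EuclideanSpace ℝ (Fin n) → Set (EuclideanSpace ℝ (Fin n)))
    (K : Set (EuclideanSpace ℝ (Fin n))) (t : ℝ≥0∞) : Set (EuclideanSpace ℝ (Fin n)) :=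
  {x | minTime F K x ≤ t}

/-- The reachable set `R = {x | minTime x < ∞}`. -/
def reachable {n : ℕ} (F : EuclideanSpace ℝ (Fin n) → Set (EuclideanSpace ℝ (Fin n)))
    (K : Set (EuclideanSpace ℝ (Fin n))) : Set (EuclideanSpace ℝ (Fin n)) :=
  {x | minTime F K x < ⊤}

/-- `x` is an optimal trajectory for `x₀`: a trajectory from `x₀` which is in the target at the
(finite) minimal time of `x₀`. -/
def IsOptimalTrajectory {n : ℕ} (F : EuclideanSpace ℝ (Fin n) → Set (EuclideanSpace ℝ (Fin n)))
    (K : Set (EuclideanSpace ℝ (Fin n))) (x₀ : EuclideanSpace ℝ (Fin n))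
    (x : ℝ → EuclideanSpace ℝ (Fin n)) : Prop :=
  minTime F K x₀ < ⊤ ∧ IsTrajectory F (minTime F K x₀).toReal x₀ x ∧
    x (minTime F K x₀).toReal ∈ K

/-- The proximal normal cone to `S` at a point `x` of `S`. -/
def proximalNormalCone {n : ℕ} (S : Set (EuclideanSpace ℝ (Fin n)))
    (x : EuclideanSpace ℝ (Fin n)) : Set (EuclideanSpace ℝ (Fin n)) :=
  {v | x ∈ S ∧ ∃ σ : ℝ, 0 ≤ σ ∧ ∀ y ∈ S, inner ℝ v (y - x) ≤ σ * ‖y - x‖ ^ 2}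

/-- The pair of arcs `(x, p)` solves the Hamiltonian inclusion
`ẋ = ∇_p H(x, p)`, `-ṗ ∈ ∂_x H(x, p)` a.e. on `[0, T]`. The gradient `∇_p H(x, p)` is only
guaranteed to exist for `p ≠ 0`, so the first equation is required only at times with `p ≠ 0`;
in particular `p = 0` identically is allowed along any trajectory. -/
def SolvesHamiltonianInclusion {n : ℕ}
    (F : EuclideanSpace ℝ (Fin n) → Set (EuclideanSpace ℝ (Fin n))) (T : ℝ)
    (x p : ℝ → EuclideanSpace ℝ (Fin n)) : Prop :=
  AbsolutelyContinuousOnInterval x 0 T ∧ AbsolutelyContinuousOnInterval p 0 T ∧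
    ∀ᵐ s ∂(volume.restrict (Icc 0 T)),
      (p s ≠ 0 → HasDerivAt x (gradient (maxHamiltonian F (x s)) (p s)) s) ∧
      ∃ q ∈ clarkeGradient (fun y => maxHamiltonian F y (p s)) (x s), HasDerivAt p (-q) s

end

end MinimumTime

/-! ### Calculus of absolutely continuous arcs. -/

section AbsoluteContinuity

open AbsolutelyContinuousOnInterval

namespace AbsolutelyContinuousOnInterval

/-! Fix `t` and a point `z` near `x t` whose minimum time is at most that of `x t`. Solve `ẏ = ∇_p
H(y, p(s))` backwards from `y t = z`, with the given dual arc `p`. Since `∇_p H(y, p)` is the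
maximizer of `⟨·, p⟩` in `F y`, the arc `y` is a trajectory of `F`. Dynamic programming
(`minTime_le_add`) then puts `y 0` in the sublevel set of `x₀`, where the proximal inequality for
`-p 0` applies.

It remains to carry this inequality from time `0` to time `t`. The Lipschitz bound (H2) and Grönwall
give `|y - x| ≤ C |z - x t|` on `[0, t]`. The derivative of `⟨p, y - x⟩` is `H(y, p) - H(x, p) - ⟨q,
y - x⟩` with `q ∈ ∂_x H(x, p)`, and semiconvexity (H1) bounds it below by a multiple of `-|y - x|²`.
Integrating costs only a term of order `|z - x t|²`; this is `exists_isTrajectory_through`.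

The flow needs `p ≠ 0`. Grönwall applied to `p` shows that otherwise `p` vanishes identically, and
the claim is trivial. Points `z` far from `x t` are handled by Cauchy–Schwarz. -/

theorem norm {E : Type*} [NormedAddCommGroup E] {f : ℝ → E} {a b : ℝ}
    (hf : AbsolutelyContinuousOnInterval f a b) :
    AbsolutelyContinuousOnInterval (fun s => ‖f s‖) a b :=
  squeeze_zero (fun _ => Finset.sum_nonneg fun _ _ => dist_nonneg)
    (fun _ => Finset.sum_le_sum fun _ _ => by
      rw [Real.dist_eq, dist_eq_norm]; exact abs_norm_sub_norm_le _ _) hf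

theorem inner {E' : Type*} [NormedAddCommGroup E'] [InnerProductSpace ℝ E'] {f g : ℝ → E'} {a b : ℝ}
    (hf : AbsolutelyContinuousOnInterval f a b) (hg : AbsolutelyContinuousOnInterval g a b) :
    AbsolutelyContinuousOnInterval (fun s => inner ℝ (f s) (g s)) a b := by
  -- Polarization reduces the inner product to products of real absolutely continuous functions.
  have h₁ := (hf.fun_add hg).norm
  have h₂ := (hf.fun_sub hg).norm
  have h := ((h₁.fun_mul h₁).fun_sub (h₂.fun_mul h₂)).const_mul (1 / 4)
  refine h.congr fun E => Finset.sum_congr rfl fun i _ => ?_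
  have key : ∀ v w : E', 1 / 4 * (‖v + w‖ * ‖v + w‖ - ‖v - w‖ * ‖v - w‖) = Inner.inner ℝ v w := by
    intro v w
    rw [← pow_two, ← pow_two, norm_add_sq_real, norm_sub_sq_real]
    ring
  simp only [key]

/-- Absolute continuity is preserved by monotone Lipschitz changes of the variable. -/
theorem comp_monotone_lipschitz {X : Type*} [PseudoMetricSpace X] {f : ℝ → X} {φ : ℝ → ℝ}
    {C : NNReal} {a b : ℝ} (hf : AbsolutelyContinuousOnInterval f (φ a) (φ b))
    (hφ : Monotone φ) (hφL : LipschitzWith C φ) :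
    AbsolutelyContinuousOnInterval (fun s => f (φ s)) a b := by
  rw [absolutelyContinuousOnInterval_iff] at hf ⊢
  intro ε hε
  obtain ⟨δ, hδ, h⟩ := hf ε hε
  refine ⟨δ / (C + 1), by positivity, fun E hE hlen => ?_⟩
  refine h (E.1, fun i => (φ (E.2 i).1, φ (E.2 i).2)) ⟨fun i hi => ?_, ?_⟩ ?_
  · exact ⟨hφ.mapsTo_uIcc (hE.1 i hi).1, hφ.mapsTo_uIcc (hE.1 i hi).2⟩
  · intro i hi j hj hij
    have hd := hE.2 hi hj hij
    simp only [Function.onFun] at hd ⊢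
    rw [Set.disjoint_left] at hd ⊢
    intro w hw hw'
    rw [uIoc, mem_Ioc, ← hφ.map_min, ← hφ.map_max] at hw hw'
    have h₁ := hφ.reflect_lt (hw.1.trans_le hw.2)
    have h₂ := hφ.reflect_lt (hw.1.trans_le hw'.2)
    have h₃ := hφ.reflect_lt (hw'.1.trans_le hw.2)
    have h₄ := hφ.reflect_lt (hw'.1.trans_le hw'.2)
    -- If the images overlap, the smaller right endpoint lies in both original half-open intervals.
    exact hd (a := min (max (E.2 i).1 (E.2 i).2) (max (E.2 j).1 (E.2 j).2))
      ⟨lt_min h₁ h₂, min_le_left _ _⟩ ⟨lt_min h₃ h₄, min_le_right _ _⟩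
  · calc ∑ i ∈ Finset.range E.1, dist (φ (E.2 i).1) (φ (E.2 i).2)
        ≤ ∑ i ∈ Finset.range E.1, C * dist (E.2 i).1 (E.2 i).2 :=
          Finset.sum_le_sum fun i _ => hφL.dist_le_mul (E.2 i).1 (E.2 i).2
      _ = C * ∑ i ∈ Finset.range E.1, dist (E.2 i).1 (E.2 i).2 := by rw [Finset.mul_sum]
      _ ≤ (C + 1) * ∑ i ∈ Finset.range E.1, dist (E.2 i).1 (E.2 i).2 := by
          gcongr
          linarith
      _ < δ := by rwa [lt_div_iff₀' (by positivity)] at hlen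

/-- An absolutely continuous function with almost everywhere nonnegative derivative is monotone. -/
theorem monotoneOn_of_ae_deriv_nonneg {f : ℝ → ℝ} {a b : ℝ} (hab : a ≤ b)
    (hf : AbsolutelyContinuousOnInterval f a b)
    (hd : ∀ᵐ s ∂(volume.restrict (Icc a b)), ∃ d, 0 ≤ d ∧ HasDerivAt f d s) :
    MonotoneOn f (Icc a b) := by
  intro u hu v hv huv
  have hsub : Icc u v ⊆ Icc a b := Icc_subset_Icc hu.1 hv.2
  have huv' : AbsolutelyContinuousOnInterval f u v :=
    hf.mono (by rwa [uIcc_of_le huv, uIcc_of_le hab])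
  rw [← sub_nonneg, ← huv'.integral_deriv_eq_sub]
  refine intervalIntegral.integral_nonneg_of_ae_restrict huv ?_
  filter_upwards [ae_restrict_of_ae_restrict_of_subset hsub hd] with s hs
  obtain ⟨d, hd0, hd⟩ := hs
  simpa [hd.deriv] using hd0

/-- Concatenation of two absolutely continuous functions that agree at the common endpoint. -/
theorem piecewise {E : Type*} [NormedAddCommGroup E] {f g : ℝ → E} {a b c : ℝ}
    (hab : a ≤ b) (hbc : b ≤ c) (hf : AbsolutelyContinuousOnInterval f a b)
    (hg : AbsolutelyContinuousOnInterval g b c) (hfg : f b = g b) :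
    AbsolutelyContinuousOnInterval (fun s => if s ≤ b then f s else g s) a c := by
  have h₁ : AbsolutelyContinuousOnInterval (fun s => f (min s b)) a c :=
    comp_monotone_lipschitz (φ := fun s => min s b) (by simpa [hab, hbc] using hf)
      (fun _ _ h => min_le_min_right b h) (LipschitzWith.id.min_const b)
  have h₂ : AbsolutelyContinuousOnInterval (fun s => g (max s b)) a c :=
    comp_monotone_lipschitz (φ := fun s => max s b) (by simpa [hab, hbc] using hg)
      (fun _ _ h => max_le_max_right b h) (LipschitzWith.id.max_const b)
  have h₃ := h₁.fun_add h₂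
  refine h₃.congr fun E => Finset.sum_congr rfl fun i _ => ?_
  -- Freezing each arc beyond `b` and adding gives the concatenation up to a constant, which
  -- distances do not see.
  have key : ∀ s, f (min s b) + g (max s b) = (if s ≤ b then f s else g s) + g b := by
    intro s
    split_ifs with hs
    · simp [hs]
    · simp [(not_le.1 hs).le, hfg, add_comm]
  simp only [key, dist_add_right]

theorem comp_add_const {X : Type*} [PseudoMetricSpace X] {f : ℝ → X} {a b : ℝ} (c : ℝ)
    (hf : AbsolutelyContinuousOnInterval f (a + c) (b + c)) :
    AbsolutelyContinuousOnInterval (fun s => f (s + c)) a b :=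
  comp_monotone_lipschitz (φ := fun s => s + c) (C := 1) hf (fun _ _ h => by simpa using h)
    (LipschitzWith.of_dist_le_mul fun _ _ => by simp)

end AbsolutelyContinuousOnInterval

end AbsoluteContinuity

namespace MinimumTime

/-! ### Semiconvexity and Clarke gradients. -/

section Semiconvex

variable {n : ℕ}

/-- Halving the step repeatedly from `y` towards `x` bounds the difference quotients at steps `2⁻ᵏ`,
with errors summing geometrically; their limit is the directional derivative. The constant `c` is
not sharp. -/
theorem SemiconvexOnWith.inner_gradient_le {Ω : Set (EuclideanSpace ℝ (Fin n))} {c : ℝ}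
    {f : EuclideanSpace ℝ (Fin n) → ℝ} (hΩ : Convex ℝ Ω) (hc : 0 ≤ c)
    (hf : SemiconvexOnWith Ω c f) {x y : EuclideanSpace ℝ (Fin n)} (hx : x ∈ Ω) (hy : y ∈ Ω)
    (hd : DifferentiableAt ℝ f x) :
    inner ℝ (gradient f x) (y - x) - c * ‖y - x‖ ^ 2 ≤ f y - f x := by
  set d := y - x with hddef
  have hseg : ∀ θ ∈ Icc (0 : ℝ) 1, x + θ • d ∈ Ω := fun θ hθ => hΩ.add_smul_sub_mem hx hy hθ
  have hhalf : ∀ θ ∈ Icc (0 : ℝ) 1, 2 * (f (x + (θ / 2) • d) - f x) ≤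
      f (x + θ • d) - f x + c * ((θ / 2) * ‖d‖) ^ 2 := by
    intro θ hθ
    have h₁ : x + (θ / 2) • d + (θ / 2) • d = x + θ • d := by module
    have h₂ : x + (θ / 2) • d - (θ / 2) • d = x := by module
    have := hf.2 (x + (θ / 2) • d) ((θ / 2) • d) (by
      rw [h₁, h₂]; exact hΩ.segment_subset hx (hseg θ hθ))
    rw [h₁, h₂, norm_smul, Real.norm_of_nonneg (by linarith [hθ.1])] at this
    linarith
  have hiter : ∀ k : ℕ, ((1 / 2 : ℝ) ^ k)⁻¹ * (f (x + ((1 / 2 : ℝ) ^ k) • d) - f x) ≤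
      f y - f x + c * ‖d‖ ^ 2 * (1 - (1 / 2) ^ k) := by
    intro k
    induction k with
    | zero => simp [d]
    | succ k ih =>
      have hθ0 : (0 : ℝ) < (1 / 2) ^ k := by positivity
      have hθ1 : (1 / 2 : ℝ) ^ k ≤ 1 := pow_le_one₀ (by norm_num) (by norm_num)
      have h := hhalf ((1 / 2) ^ k) ⟨hθ0.le, hθ1⟩
      rw [pow_succ]
      set θ : ℝ := (1 / 2) ^ k
      have e : θ * (1 / 2) = θ / 2 := by ring
      rw [e, inv_div]
      have h' : 2 / θ * (f (x + (θ / 2) • d) - f x) ≤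
          θ⁻¹ * (f (x + θ • d) - f x + c * (θ / 2 * ‖d‖) ^ 2) := by
        calc 2 / θ * (f (x + (θ / 2) • d) - f x)
            = θ⁻¹ * (2 * (f (x + (θ / 2) • d) - f x)) := by ring
          _ ≤ _ := by gcongr
      have h'' : θ⁻¹ * (c * (θ / 2 * ‖d‖) ^ 2) = c * ‖d‖ ^ 2 * (θ / 4) := by
        field_simp
        ring
      have : 0 ≤ c * ‖d‖ ^ 2 * θ := by positivity
      rw [mul_add, h''] at h'
      linarith
  have hline : HasDerivAt (fun θ : ℝ => f (x + θ • d)) (inner ℝ (gradient f x) d) 0 := by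
    have h₁ : HasDerivAt (fun θ : ℝ => x + θ • d) d 0 := by
      simpa using ((hasDerivAt_id (0 : ℝ)).smul_const d).const_add x
    have h₂ : HasFDerivAt f (fderiv ℝ f x) (x + (0 : ℝ) • d) := by simpa using hd.hasFDerivAt
    have h₃ := h₂.comp_hasDerivAt (0 : ℝ) h₁
    simpa [gradient] using! h₃
  have hlim : Tendsto (fun k : ℕ => ((1 / 2 : ℝ) ^ k)⁻¹ * (f (x + ((1 / 2 : ℝ) ^ k) • d) - f x))
      atTop (𝓝 (inner ℝ (gradient f x) d)) := by
    have h₀ : Tendsto (fun k : ℕ => (1 / 2 : ℝ) ^ k) atTop (𝓝[≠] 0) :=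
      tendsto_nhdsWithin_iff.2 ⟨tendsto_pow_atTop_nhds_zero_of_lt_one (by norm_num) (by norm_num),
        Eventually.of_forall fun k => by simp⟩
    have h₁ := hline.tendsto_slope_zero.comp h₀
    simp only [zero_add, zero_smul, add_zero, smul_eq_mul] at h₁
    exact h₁
  have hle := le_of_tendsto' (b := f y - f x + c * ‖d‖ ^ 2) hlim fun k => (hiter k).trans (by
    have : 0 ≤ c * ‖d‖ ^ 2 * (1 / 2) ^ k := by positivity
    linarith)
  linarith

/-- The inequality at differentiability points passes to limits, and as a half-space condition on
`q` it survives the convex hull. -/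
theorem SemiconvexOnWith.inner_clarkeGradient_le {Ω : Set (EuclideanSpace ℝ (Fin n))} {c : ℝ}
    {f : EuclideanSpace ℝ (Fin n) → ℝ} (hΩ : Convex ℝ Ω) (hΩo : IsOpen Ω) (hc : 0 ≤ c)
    (hf : SemiconvexOnWith Ω c f) {x y q : EuclideanSpace ℝ (Fin n)} (hx : x ∈ Ω) (hy : y ∈ Ω)
    (hq : q ∈ clarkeGradient f x) :
    inner ℝ q (y - x) - c * ‖y - x‖ ^ 2 ≤ f y - f x := by
  have hconv : Convex ℝ {v : EuclideanSpace ℝ (Fin n) |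
      inner ℝ v (y - x) ≤ f y - f x + c * ‖y - x‖ ^ 2} :=
    convex_halfSpace_le (IsLinearMap.mk (fun _ _ => inner_add_left _ _ _)
      fun a v => by simp [real_inner_smul_left]) _
  have hmem := convexHull_min (s := {v | ∃ y : ℕ → EuclideanSpace ℝ (Fin n),
    (∀ i, DifferentiableAt ℝ f (y i)) ∧ Tendsto y atTop (𝓝 x) ∧
      Tendsto (fun i => gradient f (y i)) atTop (𝓝 v)}) ?_ hconv hq
  · have : inner ℝ q (y - x) ≤ f y - f x + c * ‖y - x‖ ^ 2 := hmem
    linarith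
  · rintro v ⟨u, hud, hu, huv⟩
    have hfc : ContinuousAt f x := 
      (hf.1.continuousAt (hΩo.mem_nhds hx)).neg.congr (Eventually.of_forall fun _ => neg_neg _)
    have hsub : Tendsto (fun i => y - u i) atTop (𝓝 (y - x)) := tendsto_const_nhds.sub hu
    have hl := (huv.inner hsub).sub ((hsub.norm.pow 2).const_mul c)
    have hr : Tendsto (fun i => f y - f (u i)) atTop (𝓝 (f y - f x)) :=
      tendsto_const_nhds.sub (hfc.tendsto.comp hu)
    have := le_of_tendsto_of_tendsto hl hr (by
      filter_upwards [hu.eventually (hΩo.mem_nhds hx)] with i hi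
      exact hf.inner_gradient_le hΩ hc hi hy (hud i))
    show inner ℝ v (y - x) ≤ _
    linarith

theorem norm_le_of_mem_clarkeGradient {Ω : Set (EuclideanSpace ℝ (Fin n))} {C : ℝ} (hC : 0 ≤ C)
    {f : EuclideanSpace ℝ (Fin n) → ℝ} (hΩ : IsOpen Ω)
    (hf : ∀ x ∈ Ω, ∀ y ∈ Ω, |f x - f y| ≤ C * ‖x - y‖) {x q : EuclideanSpace ℝ (Fin n)}
    (hx : x ∈ Ω) (hq : q ∈ clarkeGradient f x) : ‖q‖ ≤ C := by
  have hL : LipschitzOnWith C.toNNReal f Ω := LipschitzOnWith.of_dist_le_mul fun u hu v hv => by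
    rw [Real.dist_eq, dist_eq_norm, Real.coe_toNNReal _ hC]
    exact hf u hu v hv
  rw [← mem_closedBall_zero_iff]
  refine convexHull_min ?_ (convex_closedBall _ _) hq
  rintro v ⟨u, hud, hu, huv⟩
  refine Metric.isClosed_closedBall.mem_of_tendsto huv ?_
  filter_upwards [hu.eventually (hΩ.mem_nhds hx)] with i hi
  have := (hud i).hasFDerivAt.le_of_lipschitzOn (hΩ.mem_nhds hi) hL
  rw [Real.coe_toNNReal _ hC] at this
  simpa [gradient] using this

end Semiconvex

/-! ### The maximized Hamiltonian. -/

section Hamiltonian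

variable {n : ℕ} {F : EuclideanSpace ℝ (Fin n) → Set (EuclideanSpace ℝ (Fin n))}

theorem inner_le_maxHamiltonian (hF : AssumptionF F) {x v : EuclideanSpace ℝ (Fin n)}
    (hv : v ∈ F x) (p : EuclideanSpace ℝ (Fin n)) : inner ℝ v p ≤ maxHamiltonian F x p :=
  le_csSup ((hF.isCompact x).image (by fun_prop)).bddAbove (mem_image_of_mem _ hv)

theorem exists_inner_eq_maxHamiltonian (hF : AssumptionF F) (x p : EuclideanSpace ℝ (Fin n)) :
    ∃ v ∈ F x, inner ℝ v p = maxHamiltonian F x p :=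
  ((hF.isCompact x).image (by fun_prop)).sSup_mem ((hF.nonempty x).image _)

theorem maxHamiltonian_smul (hF : AssumptionF F) (x p : EuclideanSpace ℝ (Fin n)) {a : ℝ}
    (ha : 0 ≤ a) : maxHamiltonian F x (a • p) = a * maxHamiltonian F x p := by
  apply le_antisymm
  · obtain ⟨v, hv, h⟩ := exists_inner_eq_maxHamiltonian hF x (a • p)
    rw [← h, real_inner_smul_right]
    exact mul_le_mul_of_nonneg_left (inner_le_maxHamiltonian hF hv p) ha
  · obtain ⟨v, hv, h⟩ := exists_inner_eq_maxHamiltonian hF x p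
    rw [← h, ← real_inner_smul_right]
    exact inner_le_maxHamiltonian hF hv _

/-- Envelope argument: `H(x, ·) - ⟨v, ·⟩` is nonnegative and vanishes at `p`, so its derivative
there is zero. -/
theorem gradient_maxHamiltonian_eq (hF : AssumptionF F) {x p v : EuclideanSpace ℝ (Fin n)}
    (hd : DifferentiableAt ℝ (maxHamiltonian F x) p) (hv : v ∈ F x)
    (hvp : inner ℝ v p = maxHamiltonian F x p) : gradient (maxHamiltonian F x) p = v := by
  have hmin : IsLocalMin (fun q => maxHamiltonian F x q - innerSL ℝ v q) p :=
    Eventually.of_forall fun q => by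
      simp only [innerSL_apply_apply, hvp, sub_self, sub_nonneg]
      exact inner_le_maxHamiltonian hF hv q
  have h := hmin.hasFDerivAt_eq_zero (hd.hasFDerivAt.sub (innerSL ℝ v).hasFDerivAt)
  rw [sub_eq_zero] at h
  rw [gradient, h]
  exact (InnerProductSpace.toDual ℝ (EuclideanSpace ℝ (Fin n))).symm_apply_apply v

theorem gradient_maxHamiltonian_mem (hF : AssumptionF F) {x p : EuclideanSpace ℝ (Fin n)}
    (hd : DifferentiableAt ℝ (maxHamiltonian F x) p) :
    gradient (maxHamiltonian F x) p ∈ F x := by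
  obtain ⟨v, hv, h⟩ := exists_inner_eq_maxHamiltonian hF x p
  rwa [gradient_maxHamiltonian_eq hF hd hv h]

theorem inner_gradient_maxHamiltonian (hF : AssumptionF F) {x p : EuclideanSpace ℝ (Fin n)}
    (hd : DifferentiableAt ℝ (maxHamiltonian F x) p) :
    inner ℝ (gradient (maxHamiltonian F x) p) p = maxHamiltonian F x p := by
  obtain ⟨v, hv, h⟩ := exists_inner_eq_maxHamiltonian hF x p
  rwa [gradient_maxHamiltonian_eq hF hd hv h]

/-- The gradients stay in the compact set `F x`, and any cluster point at `p` maximizes `⟨·, p⟩`,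
hence is the gradient there. This supplies the continuity in time needed by Picard–Lindelöf. -/
theorem continuousOn_gradient_maxHamiltonian (hF : AssumptionF F) {x : EuclideanSpace ℝ (Fin n)}
    (hd : ∀ p ≠ 0, DifferentiableAt ℝ (maxHamiltonian F x) p) :
    ContinuousOn (gradient (maxHamiltonian F x)) {0}ᶜ := by
  intro p hp
  refine (hF.isCompact x).tendsto_nhds_of_unique_mapClusterPt ?_ fun v hv hcl => ?_
  · filter_upwards [self_mem_nhdsWithin] with q hq
    exact gradient_maxHamiltonian_mem hF (hd q hq)
  · obtain ⟨U, hU, hUv⟩ := mapClusterPt_iff_ultrafilter.1 hcl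
    have hUp : Tendsto id (U : Filter _) (𝓝 p) := hU.trans nhdsWithin_le_nhds
    refine (gradient_maxHamiltonian_eq hF (hd p hp) hv
      (le_antisymm (inner_le_maxHamiltonian hF hv p) ?_)).symm
    obtain ⟨w, hw, hwp⟩ := exists_inner_eq_maxHamiltonian hF x p
    rw [← hwp]
    refine le_of_tendsto_of_tendsto (tendsto_const_nhds.inner hUp) (hUv.inner hUp) ?_
    filter_upwards [hU self_mem_nhdsWithin] with q hq
    rw [id, inner_gradient_maxHamiltonian hF (hd q hq)]
    exact inner_le_maxHamiltonian hF hw q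

theorem exists_abs_maxHamiltonian_sub_le (hF : AssumptionF F) (r : ℝ) :
    ∃ L : ℝ, 0 ≤ L ∧ ∀ p, ∀ x ∈ Metric.ball (0 : EuclideanSpace ℝ (Fin n)) r,
      ∀ y ∈ Metric.ball (0 : EuclideanSpace ℝ (Fin n)) r,
        |maxHamiltonian F x p - maxHamiltonian F y p| ≤ L * ‖p‖ * ‖x - y‖ := by
  obtain ⟨L, hL, h⟩ := hF.locallyLipschitz _ (isCompact_closedBall 0 r)
  refine ⟨L, hL.le, fun p => ?_⟩
  have key : ∀ x ∈ Metric.ball (0 : EuclideanSpace ℝ (Fin n)) r,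
      ∀ y ∈ Metric.ball (0 : EuclideanSpace ℝ (Fin n)) r,
        maxHamiltonian F x p - maxHamiltonian F y p ≤ L * ‖p‖ * ‖x - y‖ := by
    intro x hx y hy
    obtain ⟨v, hv, hvp⟩ := exists_inner_eq_maxHamiltonian hF x p
    obtain ⟨w, hw, _, ⟨b, hb, rfl⟩, rfl⟩ :=
      h x (Metric.ball_subset_closedBall hx) y (Metric.ball_subset_closedBall hy) hv
    have hb' : ‖b‖ ≤ 1 := mem_closedBall_zero_iff.1 hb
    have h₁ := inner_le_maxHamiltonian hF hw p
    have h₂ : inner ℝ b p ≤ ‖p‖ :=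
      (real_inner_le_norm b p).trans (mul_le_of_le_one_left (norm_nonneg _) hb')
    have h₃ : L * ‖y - x‖ * inner ℝ b p ≤ L * ‖y - x‖ * ‖p‖ := by gcongr
    simp only [inner_add_left, real_inner_smul_left] at hvp
    rw [← hvp, norm_sub_rev x y]
    linarith
  intro x hx y hy
  rw [abs_le]
  have := key y hy x hx
  rw [norm_sub_rev] at this
  exact ⟨by linarith, key x hx y hy⟩

/-- Positive homogeneity in `p` extends (H1) from unit vectors. -/
theorem exists_semiconvex_maxHamiltonian (hF : AssumptionF F) (hH : AssumptionH F) {r : ℝ}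
    (hr : 0 < r) : ∃ c : ℝ, 0 ≤ c ∧ ∀ p : EuclideanSpace ℝ (Fin n), p ≠ 0 →
      SemiconvexOnWith (Metric.ball 0 r) (c * ‖p‖) (fun x => maxHamiltonian F x p) := by
  obtain ⟨c, hc, h⟩ := hH.semiconvex r hr
  refine ⟨c, hc, fun p hp => ?_⟩
  have hp' : 0 < ‖p‖ := norm_pos_iff.2 hp
  have hs : ∀ x, maxHamiltonian F x p = ‖p‖ * maxHamiltonian F x (‖p‖⁻¹ • p) := by
    intro x
    rw [← maxHamiltonian_smul hF x _ hp'.le, smul_smul, mul_inv_cancel₀ hp'.ne', one_smul]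
  obtain ⟨h₁, h₂⟩ := h (‖p‖⁻¹ • p) (by
    rw [norm_smul, norm_inv, norm_norm, inv_mul_cancel₀ hp'.ne'])
  refine ⟨?_, fun x d hxd => ?_⟩
  · simp only [hs, ← mul_neg]
    exact continuousOn_const.mul h₁
  · have := mul_le_mul_of_nonneg_left (h₂ x d hxd) hp'.le
    simp only [hs]
    linarith

end Hamiltonian

end MinimumTime

namespace MinimumTime

/-! ### Global solvability of the backward equation. -/

section ODE

variable {n : ℕ}

/-- Existence on the whole interval, with prescribed terminal value, for a bounded Lipschitz
time-dependent vector field. -/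
theorem exists_solution_terminal {g : ℝ → EuclideanSpace ℝ (Fin n) → EuclideanSpace ℝ (Fin n)}
    {t : ℝ} (ht : 0 ≤ t) {C M : NNReal} (hL : ∀ s ∈ Icc 0 t, LipschitzWith C (g s))
    (hc : ∀ y, ContinuousOn (g · y) (Icc 0 t)) (hM : ∀ s ∈ Icc 0 t, ∀ y, ‖g s y‖ ≤ M)
    (z : EuclideanSpace ℝ (Fin n)) :
    ∃ y : ℝ → EuclideanSpace ℝ (Fin n), y t = z ∧ AbsolutelyContinuousOnInterval y 0 t ∧
      ∀ s ∈ Ioo 0 t, HasDerivAt y (g s (y s)) s := by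
  -- Speed at most `M` keeps solutions within `M * t` of `z`, so this radius covers all of `[0, t]`.
  have hpl : IsPicardLindelof g (tmin := 0) (tmax := t) ⟨t, ht, le_rfl⟩ z (M * t.toNNReal) 0 M C :=
    { lipschitzOnWith := fun s hs => (hL s hs).lipschitzOnWith
      continuousOn := fun y _ => hc y
      norm_le := fun s hs y _ => hM s hs y
      mul_max_le := by simp [ht] }
  obtain ⟨y, hyt, hy⟩ := hpl.exists_eq_forall_mem_Icc_hasDerivWithinAt₀
  refine ⟨y, hyt, ?_, fun s hs => (hy s (Ioo_subset_Icc_self hs)).hasDerivAt (Icc_mem_nhds hs.1 hs.2)⟩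
  have hlip : LipschitzOnWith M y (Icc 0 t) :=
    (convex_Icc 0 t).lipschitzOnWith_of_nnnorm_hasDerivWithin_le hy
      fun s hs => hM s hs (y s)
  exact LipschitzOnWith.absolutelyContinuousOnInterval (by rwa [uIcc_of_le ht])

/-- A bounded `1`-Lipschitz map that is the identity on a given ball. -/
theorem exists_lipschitz_truncation (n : ℕ) (R : ℝ) :
    ∃ r : ℝ, 0 < r ∧ ∃ π : EuclideanSpace ℝ (Fin n) → EuclideanSpace ℝ (Fin n),
      LipschitzWith 1 π ∧ (∀ y, ‖y‖ ≤ R → π y = y) ∧ ∀ y, π y ∈ Metric.ball 0 r := by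
  let π : EuclideanSpace ℝ (Fin n) → EuclideanSpace ℝ (Fin n) :=
    fun y => WithLp.toLp 2 fun i => max (-|R|) (min |R| (y i))
  refine ⟨√(∑ _i : Fin n, |R| ^ 2) + 1, by positivity, π, ?_, fun y hy => ?_, fun y => ?_⟩
  · refine LipschitzWith.of_dist_le_mul fun u v => ?_
    rw [NNReal.coe_one, one_mul, EuclideanSpace.dist_eq, EuclideanSpace.dist_eq]
    refine Real.sqrt_le_sqrt (Finset.sum_le_sum fun i _ => ?_)
    gcongr
    exact (((LipschitzWith.id (α := ℝ)).const_min |R|).const_max (-|R|)).dist_le_mul (u i) (v i)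
      |>.trans (by simp)
  · ext i
    have h := abs_le.1 ((PiLp.norm_apply_le y i).trans (hy.trans (le_abs_self R)))
    simp [π, h.1, h.2]
  · rw [mem_ball_zero_iff, EuclideanSpace.norm_eq]
    refine lt_of_le_of_lt (Real.sqrt_le_sqrt (Finset.sum_le_sum fun i _ => ?_)) (lt_add_one _)
    have := abs_nonneg R
    exact pow_le_pow_left₀ (norm_nonneg _)
      (abs_le.2 ⟨le_max_left _ _, max_le (by linarith) (min_le_left _ _)⟩) 2

end ODE

/-! ### Grönwall-type estimates. -/

section Estimates

variable {E : Type*} [NormedAddCommGroup E] [InnerProductSpace ℝ E]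

theorem absolutelyContinuousOnInterval_exp_mul (k a b : ℝ) :
    AbsolutelyContinuousOnInterval (fun s => Real.exp (k * s)) a b :=
  ContDiffOn.absolutelyContinuousOnInterval (ContDiff.contDiffOn (by fun_prop))

/-- Two-sided Grönwall estimate for absolutely continuous arcs. -/
theorem norm_sq_le_exp_mul {u : ℝ → E} {a b L : ℝ} (hab : a ≤ b)
    (hu : AbsolutelyContinuousOnInterval u a b)
    (hd : ∀ᵐ s ∂(volume.restrict (Icc a b)), ∃ v, HasDerivAt u v s ∧ ‖v‖ ≤ L * ‖u s‖)
    {s : ℝ} (hs : s ∈ Icc a b) {s' : ℝ} (hs' : s' ∈ Icc a b) :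
    ‖u s‖ ^ 2 ≤ Real.exp (2 * L * |s - s'|) * ‖u s'‖ ^ 2 := by
  have hsq := hu.inner hu
  have hbound : ∀ {τ : ℝ} {v : E}, ‖v‖ ≤ L * ‖u τ‖ →
      |inner ℝ (u τ) v| ≤ L * inner ℝ (u τ) (u τ) := by
    intro τ v hv
    rw [real_inner_self_eq_norm_sq]
    calc |inner ℝ (u τ) v| ≤ ‖u τ‖ * ‖v‖ := abs_real_inner_le_norm _ _
      _ ≤ ‖u τ‖ * (L * ‖u τ‖) := by gcongr
      _ = L * ‖u τ‖ ^ 2 := by ring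
  have hexp : ∀ k τ : ℝ, HasDerivAt (fun s => Real.exp (k * s)) (Real.exp (k * τ) * k) τ :=
    fun k τ => by simpa using! ((hasDerivAt_id τ).const_mul k).exp
  have hup := ((absolutelyContinuousOnInterval_exp_mul (2 * L) a b).fun_mul
    hsq).monotoneOn_of_ae_deriv_nonneg hab (by
      filter_upwards [hd] with τ ⟨v, hv, hvL⟩
      refine ⟨_, ?_, (hexp (2 * L) τ).mul (hv.inner ℝ hv)⟩
      have := (abs_le.1 (hbound hvL)).1
      rw [real_inner_comm (u τ) v]
      have h : 0 ≤ Real.exp (2 * L * τ) * (2 * (L * inner ℝ (u τ) (u τ) + inner ℝ (u τ) v)) :=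
        mul_nonneg (Real.exp_pos _).le (by linarith)
      linarith)
  have hdown := ((absolutelyContinuousOnInterval_exp_mul (-(2 * L)) a b).fun_mul
    hsq).fun_neg.monotoneOn_of_ae_deriv_nonneg hab (by
      filter_upwards [hd] with τ ⟨v, hv, hvL⟩
      refine ⟨_, ?_, ((hexp (-(2 * L)) τ).mul (hv.inner ℝ hv)).neg⟩
      have := (abs_le.1 (hbound hvL)).2
      rw [real_inner_comm (u τ) v]
      have h : 0 ≤ Real.exp (-(2 * L) * τ) * (2 * (L * inner ℝ (u τ) (u τ) - inner ℝ (u τ) v)) :=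
        mul_nonneg (Real.exp_pos _).le (by linarith)
      linarith)
  rcases le_total s s' with h | h
  · have h₁ := hup hs hs' h
    simp only [real_inner_self_eq_norm_sq] at h₁
    rw [abs_of_nonpos (by linarith), show 2 * L * -(s - s') = 2 * L * s' - 2 * L * s by ring,
      Real.exp_sub, div_mul_eq_mul_div, le_div_iff₀' (Real.exp_pos _)]
    exact h₁
  · have h₁ := hdown hs' hs h
    simp only [real_inner_self_eq_norm_sq, neg_le_neg_iff] at h₁
    rw [abs_of_nonneg (by linarith),
      show 2 * L * (s - s') = -(2 * L) * s' - (-(2 * L) * s) by ring,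
      Real.exp_sub, div_mul_eq_mul_div, le_div_iff₀' (Real.exp_pos _)]
    exact h₁

/-- Lower bound for the increment of `⟨p, u⟩` when its derivative is almost everywhere bounded
below. -/
theorem inner_sub_le_inner {p u : ℝ → E} {a b c : ℝ} (hab : a ≤ b)
    (hp : AbsolutelyContinuousOnInterval p a b) (hu : AbsolutelyContinuousOnInterval u a b)
    (hd : ∀ᵐ s ∂(volume.restrict (Icc a b)), ∃ q v, HasDerivAt p q s ∧ HasDerivAt u v s ∧
      -c ≤ inner ℝ q (u s) + inner ℝ (p s) v) :
    inner ℝ (p a) (u a) - c * (b - a) ≤ inner ℝ (p b) (u b) := by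
  have hlin : AbsolutelyContinuousOnInterval (fun s : ℝ => c * s) a b :=
    ContDiffOn.absolutelyContinuousOnInterval (ContDiff.contDiffOn (by fun_prop))
  have h := ((hp.inner hu).fun_add hlin).monotoneOn_of_ae_deriv_nonneg hab (by
    filter_upwards [hd] with s ⟨q, v, hq, hv, h⟩
    refine ⟨_, ?_, (hq.inner ℝ hv).add ((hasDerivAt_id s).const_mul c)⟩
    linarith) (left_mem_Icc.2 hab) (right_mem_Icc.2 hab) hab
  simp only at h
  linarith

end Estimates

/-! ### Trajectories and dynamic programming. -/

section Trajectories

variable {n : ℕ} {F : EuclideanSpace ℝ (Fin n) → Set (EuclideanSpace ℝ (Fin n))}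
  {K : Set (EuclideanSpace ℝ (Fin n))}

theorem IsTrajectory.shift {T t : ℝ} {x₀ : EuclideanSpace ℝ (Fin n)}
    {x : ℝ → EuclideanSpace ℝ (Fin n)} (hx : IsTrajectory F T x₀ x) (ht : t ∈ Icc 0 T) :
    IsTrajectory F (T - t) (x t) (fun s => x (s + t)) := by
  refine ⟨?_, by simp, ?_⟩
  · apply AbsolutelyContinuousOnInterval.comp_add_const
    refine hx.1.mono ?_
    rw [uIcc_of_le (ht.1.trans ht.2), zero_add, sub_add_cancel, uIcc_of_le ht.2]
    exact Icc_subset_Icc_left ht.1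
  · have h := hx.2.2
    rw [ae_restrict_iff' measurableSet_Icc] at h ⊢
    filter_upwards [(measurePreserving_add_right volume t).quasiMeasurePreserving.ae h] with s hs hsI
    obtain ⟨v, hv, hd⟩ := hs ⟨by linarith [hsI.1, ht.1], by linarith [hsI.2]⟩
    exact ⟨v, hv, hd.comp_add_const s t⟩

theorem IsTrajectory.concat {t T : ℝ} (ht : 0 ≤ t) (hT : 0 ≤ T) {w : EuclideanSpace ℝ (Fin n)}
    {y z : ℝ → EuclideanSpace ℝ (Fin n)} (hy : IsTrajectory F t w y)
    (hz : IsTrajectory F T (y t) z) :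
    IsTrajectory F (t + T) w (fun s => if s ≤ t then y s else z (s - t)) := by
  refine ⟨?_, by simp [ht, hy.2.1], ?_⟩
  · refine AbsolutelyContinuousOnInterval.piecewise ht (by linarith) hy.1 ?_ (by simp [hz.2.1])
    simp only [sub_eq_add_neg]
    exact AbsolutelyContinuousOnInterval.comp_add_const (-t) (by simpa using hz.1)
  · have h₁ := hy.2.2
    have h₂ := hz.2.2
    rw [ae_restrict_iff' measurableSet_Icc] at h₁ h₂ ⊢
    filter_upwards [h₁, (measurePreserving_sub_right volume t).quasiMeasurePreserving.ae h₂,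
      Measure.ae_ne volume t] with s hs₁ hs₂ hst hsI
    rcases lt_or_gt_of_ne hst with h | h
    · obtain ⟨v, hv, hd⟩ := hs₁ ⟨hsI.1, h.le⟩
      refine ⟨v, by simpa [h.le] using hv, hd.congr_of_eventuallyEq ?_⟩
      filter_upwards [Iio_mem_nhds h] with τ hτ
      simp [(mem_Iio.1 hτ).le]
    · obtain ⟨v, hv, hd⟩ := hs₂ ⟨by linarith, by linarith [hsI.2]⟩
      refine ⟨v, by simpa [h.not_ge] using hv, (hd.comp_sub_const s t).congr_of_eventuallyEq ?_⟩
      filter_upwards [Ioi_mem_nhds h] with τ hτ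
      simp [(mem_Ioi.1 hτ).not_ge]

theorem minTime_le_of_isTrajectory {T : ℝ} (hT : 0 ≤ T) {w : EuclideanSpace ℝ (Fin n)}
    {y : ℝ → EuclideanSpace ℝ (Fin n)} (hy : IsTrajectory F T w y) (hyK : y T ∈ K) :
    minTime F K w ≤ ENNReal.ofReal T := by
  -- The infimum only admits positive times; at time `0` the point is already in the target.
  rcases hT.eq_or_lt with rfl | hT
  · have : w ∈ K := hy.2.1 ▸ hyK
    simp [minTime, this]
  · rw [minTime]
    split_ifs
    · exact bot_le
    · exact sInf_le ⟨T, hT, rfl, y, hy, hyK⟩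

theorem minTime_le_add {t : ℝ} (ht : 0 ≤ t) {w : EuclideanSpace ℝ (Fin n)}
    {y : ℝ → EuclideanSpace ℝ (Fin n)} (hy : IsTrajectory F t w y) :
    minTime F K w ≤ ENNReal.ofReal t + minTime F K (y t) := by
  by_cases hyK : y t ∈ K
  · exact (minTime_le_of_isTrajectory ht hy hyK).trans le_self_add
  · rw [minTime.eq_def F K (y t), if_neg hyK, ← tsub_le_iff_left]
    refine le_sInf ?_
    rintro _ ⟨T, hT, rfl, z, hz, hzK⟩
    rw [tsub_le_iff_left, ← ENNReal.ofReal_add ht hT.le]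
    refine minTime_le_of_isTrajectory (by linarith) (hy.concat ht hT.le hz) ?_
    simpa [hT.not_ge] using hzK

end Trajectories

end MinimumTime

namespace MinimumTime

/-! ### Propagation along the Hamiltonian arc. -/

section Propagation

variable {n : ℕ} {F : EuclideanSpace ℝ (Fin n) → Set (EuclideanSpace ℝ (Fin n))}

/-- A dual arc that vanishes somewhere vanishes identically. -/
theorem SolvesHamiltonianInclusion.eq_zero_or_ne_zero (hF : AssumptionF F) {T : ℝ} (hT : 0 ≤ T)
    {x p : ℝ → EuclideanSpace ℝ (Fin n)} (h : SolvesHamiltonianInclusion F T x p) :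
    (∀ s ∈ Icc 0 T, p s = 0) ∨ ∀ s ∈ Icc 0 T, p s ≠ 0 := by
  obtain ⟨hx, hp, hxp⟩ := h
  rw [or_iff_not_imp_right]
  push Not
  rintro ⟨s₀, hs₀, hp₀⟩ s hs
  obtain ⟨X, hX⟩ := hx.exists_bound
  rw [uIcc_of_le hT] at hX
  obtain ⟨L, hL, hHL⟩ := exists_abs_maxHamiltonian_sub_le hF (X + 1)
  -- `H(·, p)` is Lipschitz with constant `L * ‖p‖`, so `‖ṗ‖ ≤ L * ‖p‖`. The two-sided Grönwall
  -- bound spreads the zero at `s₀` both ways.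
  have hgr := norm_sq_le_exp_mul (L := L) hT hp (by
    filter_upwards [hxp, ae_restrict_mem measurableSet_Icc] with τ ⟨_, q, hq, hd⟩ hτ
    refine ⟨-q, hd, ?_⟩
    rw [norm_neg]
    exact norm_le_of_mem_clarkeGradient (by positivity) Metric.isOpen_ball (hHL (p τ))
      (mem_ball_zero_iff.2 ((hX τ hτ).trans_lt (lt_add_one X))) hq) hs hs₀
  rw [hp₀, norm_zero] at hgr
  have : ‖p s‖ ^ 2 = 0 := le_antisymm (by simpa using hgr) (by positivity)
  simpa using this

/-- Near points of a Hamiltonian arc with nonvanishing dual arc can be reached at time `t` by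
trajectories along which the pairing with the dual arc is controlled to second order. -/
theorem SolvesHamiltonianInclusion.exists_isTrajectory_through (hF : AssumptionF F)
    (hH : AssumptionH F) {T : ℝ} {x p : ℝ → EuclideanSpace ℝ (Fin n)}
    (h : SolvesHamiltonianInclusion F T x p) (hp0 : ∀ s ∈ Icc 0 T, p s ≠ 0) {t : ℝ}
    (ht : t ∈ Icc 0 T) :
    ∃ δ > 0, ∃ A ≥ 0, ∃ D ≥ 0, ∀ z : EuclideanSpace ℝ (Fin n), ‖z - x t‖ ≤ δ →
      ∃ y : ℝ → EuclideanSpace ℝ (Fin n), IsTrajectory F t (y 0) y ∧ y t = z ∧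
        ‖y 0 - x 0‖ ^ 2 ≤ A * ‖z - x t‖ ^ 2 ∧
        inner ℝ (p 0) (y 0 - x 0) - D * ‖z - x t‖ ^ 2 ≤ inner ℝ (p t) (z - x t) := by
  obtain ⟨hx, hp, hxp⟩ := h
  have hT : 0 ≤ T := ht.1.trans ht.2
  have hsub : Icc 0 t ⊆ Icc 0 T := Icc_subset_Icc_right ht.2
  have husub : uIcc 0 t ⊆ uIcc 0 T := by rwa [uIcc_of_le ht.1, uIcc_of_le hT]
  obtain ⟨X, hX⟩ := hx.exists_bound
  obtain ⟨P, hP⟩ := hp.exists_bound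
  rw [uIcc_of_le hT] at hX hP
  have hP0 : 0 ≤ P := (norm_nonneg _).trans (hP t ht)
  -- Composing with `π` makes the field bounded and globally Lipschitz; the margin `1` beyond the
  -- bound `X` on the arc leaves room for `y`.
  obtain ⟨r, hr, π, hπL, hπ, hπr⟩ := exists_lipschitz_truncation n (X + 1)
  obtain ⟨L, hL, hHL⟩ := hH.gradient_lipschitz r hr
  obtain ⟨c, hc, hHc⟩ := exists_semiconvex_maxHamiltonian hF hH hr
  obtain ⟨γ, hγ, hFγ⟩ := hF.linearGrowth
  have hdiff : ∀ y ∈ Metric.ball (0 : EuclideanSpace ℝ (Fin n)) r, ∀ q ≠ 0,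
      DifferentiableAt ℝ (maxHamiltonian F y) q := fun y hy q hq => (hHL q hq).1 y hy
  have hxball : ∀ s ∈ Icc 0 T, π (x s) = x s := fun s hs =>
    hπ _ ((hX s hs).trans (lt_add_one X).le)
  let G : ℝ → EuclideanSpace ℝ (Fin n) → EuclideanSpace ℝ (Fin n) :=
    fun s y => gradient (maxHamiltonian F (π y)) (p s)
  have hGL : ∀ s ∈ Icc 0 t, ∀ u v, ‖G s u - G s v‖ ≤ L * ‖u - v‖ := by
    intro s hs u v
    refine ((hHL (p s) (hp0 s (hsub hs))).2 _ (hπr u) _ (hπr v)).trans ?_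
    gcongr
    simpa [dist_eq_norm] using hπL.dist_le_mul u v
  have hGF : ∀ s ∈ Icc 0 t, ∀ u, G s u ∈ F (π u) := fun s hs u =>
    gradient_maxHamiltonian_mem hF (hdiff _ (hπr u) _ (hp0 s (hsub hs)))
  -- This `δ` makes the Grönwall bound give `‖y s - x s‖ ≤ 1`, so `y` never meets the truncation.
  refine ⟨Real.exp (-(L * t)), Real.exp_pos _, Real.exp (2 * L * t), (Real.exp_pos _).le,
    c * P * Real.exp (2 * L * t) * t, by have := ht.1; positivity, fun z hz => ?_⟩
  obtain ⟨y, hyt, hyac, hyd⟩ := exists_solution_terminal (g := G) (C := L.toNNReal)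
    (M := (γ * (1 + r)).toNNReal) ht.1
    (fun s hs => LipschitzWith.of_dist_le_mul fun u v => by
      rw [dist_eq_norm, dist_eq_norm, Real.coe_toNNReal _ hL]; exact hGL s hs u v)
    (fun y => (continuousOn_gradient_maxHamiltonian hF (hdiff _ (hπr y))).comp
      ((hp.mono husub).continuousOn.mono (by rw [uIcc_of_le ht.1]))
      fun s hs => hp0 s (hsub hs))
    (fun s hs y => by
      rw [Real.coe_toNNReal _ (by positivity)]
      refine (hFγ _ _ (hGF s hs y)).trans ?_
      gcongr
      exact (mem_ball_zero_iff.1 (hπr y)).le) z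
  have hae : ∀ᵐ s ∂(volume.restrict (Icc 0 t)), s ∈ Icc 0 t ∧ HasDerivAt y (G s (y s)) s ∧
      HasDerivAt x (G s (x s)) s ∧
      ∃ q ∈ clarkeGradient (fun y => maxHamiltonian F y (p s)) (x s), HasDerivAt p (-q) s := by
    filter_upwards [ae_restrict_mem measurableSet_Icc, ae_restrict_of_ae (Measure.ae_ne volume 0),
      ae_restrict_of_ae (Measure.ae_ne volume t), ae_restrict_of_ae_restrict_of_subset hsub hxp]
      with s hs hs₀ hst hxps
    refine ⟨hs, hyd s ⟨lt_of_le_of_ne hs.1 hs₀.symm, lt_of_le_of_ne hs.2 hst⟩, ?_, hxps.2⟩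
    simpa only [G, hxball s (hsub hs)] using hxps.1 (hp0 s (hsub hs))
  have huac : AbsolutelyContinuousOnInterval (fun s => y s - x s) 0 t :=
    hyac.fun_sub (hx.mono husub)
  have hgr : ∀ s ∈ Icc 0 t, ‖y s - x s‖ ^ 2 ≤ Real.exp (2 * L * t) * ‖z - x t‖ ^ 2 := by
    intro s hs
    have := norm_sq_le_exp_mul (L := L) ht.1 huac (by
      filter_upwards [hae] with τ ⟨hτ, hdy, hdx, _⟩
      exact ⟨_, hdy.sub hdx, hGL τ hτ _ _⟩) hs (right_mem_Icc.2 ht.1)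
    simp only [hyt] at this
    refine this.trans ?_
    gcongr
    rw [abs_of_nonpos (by linarith [hs.2])]
    linarith [hs.1]
  have hyball : ∀ s ∈ Icc 0 t, π (y s) = y s := by
    intro s hs
    refine hπ _ ?_
    have h₁ : ‖y s - x s‖ ≤ 1 := by
      rw [← sq_le_one_iff₀ (norm_nonneg _)]
      refine (hgr s hs).trans ?_
      calc Real.exp (2 * L * t) * ‖z - x t‖ ^ 2
          ≤ Real.exp (2 * L * t) * Real.exp (-(L * t)) ^ 2 := by gcongr
        _ = 1 := by
          rw [← Real.exp_nat_mul, ← Real.exp_add, Real.exp_eq_one_iff]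
          push_cast
          ring
    have h₂ := norm_add_le (y s - x s) (x s)
    rw [sub_add_cancel] at h₂
    linarith [hX s (hsub hs)]
  refine ⟨y, ⟨hyac, rfl, ?_⟩, hyt, hgr 0 (left_mem_Icc.2 ht.1), ?_⟩
  · filter_upwards [hae] with s ⟨hs, hdy, _⟩
    refine ⟨_, ?_, hdy⟩
    have := hGF s hs (y s)
    rwa [hyball s hs] at this
  · have hfin := inner_sub_le_inner (c := c * P * (Real.exp (2 * L * t) * ‖z - x t‖ ^ 2)) ht.1
      (hp.mono husub) huac (by
        filter_upwards [hae] with s ⟨hs, hdy, hdx, q, hq, hdp⟩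
        refine ⟨_, _, hdp, hdy.sub hdx, ?_⟩
        have hps := hp0 s (hsub hs)
        have hxr : x s ∈ Metric.ball (0 : EuclideanSpace ℝ (Fin n)) r :=
          hxball s (hsub hs) ▸ hπr (x s)
        have hyr : y s ∈ Metric.ball (0 : EuclideanSpace ℝ (Fin n)) r :=
          hyball s hs ▸ hπr (y s)
        have hprox := (hHc (p s) hps).inner_clarkeGradient_le (convex_ball 0 r) Metric.isOpen_ball
          (by positivity) hxr hyr hq
        have hcP : c * ‖p s‖ * ‖y s - x s‖ ^ 2 ≤
            c * P * (Real.exp (2 * L * t) * ‖z - x t‖ ^ 2) := by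
          gcongr
          · exact hP s (hsub hs)
          · exact hgr s hs
        simp only [G, hxball s (hsub hs), hyball s hs]
        -- The velocities paired with `p s` become Hamiltonian values, so `hprox` bounds the whole
        -- derivative.
        rw [inner_neg_left, inner_sub_right (p s), real_inner_comm _ (p s),
          inner_gradient_maxHamiltonian hF (hdiff _ hyr _ hps), real_inner_comm _ (p s),
          inner_gradient_maxHamiltonian hF (hdiff _ hxr _ hps)]
        linarith)
    simp only [hyt, sub_zero] at hfin
    linarith

end Propagation

end MinimumTime

/-! ### The main theorem. -/

theorem mainTheorem8 {n : ℕ}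
    (F : EuclideanSpace ℝ (Fin n) → Set (EuclideanSpace ℝ (Fin n)))
    (K : Set (EuclideanSpace ℝ (Fin n))) (hK : IsClosed K)
    (hF : MinimumTime.AssumptionF F) (hH : MinimumTime.AssumptionH F)
    (x₀ : EuclideanSpace ℝ (Fin n)) (hx₀ : x₀ ∈ MinimumTime.reachable F K \ K)
    (x p : ℝ → EuclideanSpace ℝ (Fin n))
    (hx : MinimumTime.IsOptimalTrajectory F K x₀ x)
    (hxp : MinimumTime.SolvesHamiltonianInclusion F (MinimumTime.minTime F K x₀).toReal x p)
    (hp₀ : -p 0 ∈ MinimumTime.proximalNormalCone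
      (MinimumTime.reachableAt F K (MinimumTime.minTime F K x₀)) x₀) :
    (∀ t ∈ Set.Icc 0 (MinimumTime.minTime F K x₀).toReal,
      -p t ∈ MinimumTime.proximalNormalCone
        (MinimumTime.reachableAt F K (MinimumTime.minTime F K (x t))) (x t)) ∧
    -p (MinimumTime.minTime F K x₀).toReal ∈
      MinimumTime.proximalNormalCone K (x (MinimumTime.minTime F K x₀).toReal) := by
  obtain ⟨hfin, hxtraj, hxK⟩ := hx
  obtain ⟨-, σ, hσ, hprox⟩ := hp₀
  have hTeq : ENNReal.ofReal (MinimumTime.minTime F K x₀).toReal = MinimumTime.minTime F K x₀ :=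
    ENNReal.ofReal_toReal hfin.ne
  have hT : 0 ≤ (MinimumTime.minTime F K x₀).toReal := ENNReal.toReal_nonneg
  generalize hTdef : (MinimumTime.minTime F K x₀).toReal = T at *
  have main : ∀ t ∈ Set.Icc 0 T, -p t ∈ MinimumTime.proximalNormalCone
      (MinimumTime.reachableAt F K (MinimumTime.minTime F K (x t))) (x t) := by
    intro t ht
    have hmem : x t ∈ MinimumTime.reachableAt F K (MinimumTime.minTime F K (x t)) := by
      simp [MinimumTime.reachableAt]
    rcases hxp.eq_zero_or_ne_zero hF hT with hzero | hne
    · exact ⟨hmem, 0, le_rfl, fun y _ => by simp [hzero t ht]⟩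
    obtain ⟨δ, hδ, A, hA, D, hD, hthrough⟩ := hxp.exists_isTrajectory_through hF hH hne ht
    -- `σ * A + D` serves points within `δ` of `x t`; `‖p t‖ / δ` serves the others by
    -- Cauchy–Schwarz.
    refine ⟨hmem, σ * A + D + ‖p t‖ / δ, by positivity, fun z hz => ?_⟩
    rcases le_or_gt ‖z - x t‖ δ with hnear | hfar
    · obtain ⟨y, hy, rfl, hyA, hyD⟩ := hthrough z hnear
      have hxt : MinimumTime.minTime F K (x t) ≤ ENNReal.ofReal (T - t) :=
        MinimumTime.minTime_le_of_isTrajectory (by linarith [ht.2]) (hxtraj.shift ht)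
          (by simpa using hxK)
      have hy0 : y 0 ∈ MinimumTime.reachableAt F K (MinimumTime.minTime F K x₀) := by
        show MinimumTime.minTime F K (y 0) ≤ _
        calc MinimumTime.minTime F K (y 0)
            ≤ ENNReal.ofReal t + MinimumTime.minTime F K (y t) :=
              MinimumTime.minTime_le_add ht.1 hy
          _ ≤ ENNReal.ofReal t + ENNReal.ofReal (T - t) := by
              gcongr
              exact hz.trans hxt
          _ = MinimumTime.minTime F K x₀ := by
              rw [← ENNReal.ofReal_add ht.1 (by linarith [ht.2]), add_sub_cancel, hTeq]
      have h₁ := hprox _ hy0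
      rw [← hxtraj.2.1, inner_neg_left] at h₁
      have h₂ : σ * ‖y 0 - x 0‖ ^ 2 ≤ σ * (A * ‖y t - x t‖ ^ 2) := by gcongr
      have h₃ : 0 ≤ ‖p t‖ / δ * ‖y t - x t‖ ^ 2 := by positivity
      rw [inner_neg_left]
      linarith
    · have h₁ : 0 ≤ (σ * A + D) * ‖z - x t‖ ^ 2 := by positivity
      have h₂ : ‖p t‖ * ‖z - x t‖ ≤ ‖p t‖ / δ * ‖z - x t‖ ^ 2 := by
        rw [div_mul_eq_mul_div, le_div_iff₀ hδ, pow_two, mul_assoc]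
        gcongr
      have h₃ := real_inner_le_norm (-p t) (z - x t)
      rw [norm_neg] at h₃
      linarith
  refine ⟨main, hxK, ?_⟩
  obtain ⟨-, τ, hτ, h⟩ := main T ⟨hT, le_rfl⟩
  refine ⟨τ, hτ, fun y hy => h y ?_⟩
  -- Target points have minimum time `0`, so `K` lies in every sublevel set and the normal
  -- inequality restricts to it.
  simp [MinimumTime.reachableAt, MinimumTime.minTime, hy]
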